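/- Let $\mu$ be the Möbius function and, for real $x \ge 1$, let $M(x)=\sum_{n\le x}\mu(n)$, the sum running over the positive integers $n\le x$. Then $M(x)=o(x)$ as $x\to\infty$ (over the reals), i.e. $\lim_{x\to\infty} M(x)/x = 0$. -/

import Mathlib

/-- The Mertens function `M(x) = ∑_{n ≤ x} μ(n)` of a real variable `x`, where `n` runs over the
positive integers and `μ` is the Möbius function. -/
noncomputable def mertensFunction (x : ℝ) : ℝ :=
  ∑ n ∈ Finset.Icc 1 ⌊x⌋₊, (ArithmeticFunction.moebius n : ℝ)

open MeasureTheory Filter Topology Set FourierTransform SchwartzMap Complex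

/-! Put a(t) = M(e^t)e^{-t}, which is bounded by 1. For Re z > 0 its Laplace transform is
1/((z+1)ζ(z+1)). This extends continuously to Re z ≥ 0, because ζ has no zeros on Re s = 1 and its
pole at s = 1 only makes the quotient vanish at z = 0 (`continuousOn_mertensLaplace`). By
Riemann-Lebesgue on the boundary line, averages of a against Fourier transforms of compactly
supported functions tend to 0. Since a oscillates slowly (`abs_mertensExp_sub_le`), a narrow kernel
of integral 1 changes it little, so a itself tends to 0 (`tendsto_zero_of_laplace_continuousOn`). -/

/-! ### Tauberian theorem for Laplace transforms -/

/-- A damped convolution of a bounded function with a Fourier transform, expressed through the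
Laplace transform of the function. -/
theorem integral_mul_exp_mul_fourier_eq {a : ℝ → ℂ} {C : ℝ} {G : ℂ → ℂ}
    (ha : Measurable a) (hC : ∀ t, ‖a t‖ ≤ C)
    (hG : ∀ z : ℂ, 0 < z.re → ∫ t in Ioi (0 : ℝ), a t * cexp (-(z * t)) = G z)
    (f : 𝓢(ℝ, ℂ)) {σ : ℝ} (hσ : 0 < σ) (y : ℝ) :
    ∫ t in Ioi (0 : ℝ), a t * cexp (-(σ * t)) * 𝓕 (f : ℝ → ℂ) (y - t) =
      ∫ v : ℝ, Real.fourierChar (-(v * y)) • (f v * G (σ - 2 * Real.pi * v * I)) := by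
  have key : ∀ t v : ℝ, a t * cexp (-(σ * t)) * (Real.fourierChar (-(v * (y - t))) • f v) =
      Real.fourierChar (-(v * y)) •
        (f v * (a t * cexp (-((σ - 2 * Real.pi * v * I) * t)))) := by
    intro t v
    simp only [Circle.smul_def, Real.fourierChar_apply, smul_eq_mul]
    have : cexp (-(σ * t)) * cexp (↑(2 * Real.pi * -(v * (y - t))) * I) =
        cexp (↑(2 * Real.pi * -(v * y)) * I) * cexp (-((σ - 2 * Real.pi * v * I) * t)) := by
      rw [← Complex.exp_add, ← Complex.exp_add]
      congr 1
      push_cast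
      ring
    linear_combination (a t * f v) * this
  -- The damping makes a absolutely integrable, which Fubini needs.
  have h1 : Integrable (fun t : ℝ => a t * cexp (-(σ * t))) (volume.restrict (Ioi 0)) := by
    have h0 : Integrable (fun t : ℝ => Real.exp (-σ * t)) (volume.restrict (Ioi 0)) :=
      exp_neg_integrableOn_Ioi 0 hσ
    refine Integrable.mono' (h0.const_mul C) (by fun_prop) (Eventually.of_forall fun t => ?_)
    rw [norm_mul]
    refine mul_le_mul (hC t) ?_ (norm_nonneg _) ((norm_nonneg _).trans (hC t))
    rw [Complex.norm_exp]
    simp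
  have h2 : Integrable (Function.uncurry fun t v : ℝ =>
      a t * cexp (-(σ * t)) * (Real.fourierChar (-(v * (y - t))) • f v))
      ((volume.restrict (Ioi 0)).prod volume) := by
    refine Integrable.mono (h1.mul_prod f.integrable) ?_ (Eventually.of_forall fun p => ?_)
    · have hf := f.continuous.measurable
      have he : Measurable fun p : ℝ × ℝ => (Real.fourierChar (-(p.2 * (y - p.1))) : ℂ) := by
        have : Continuous fun p : ℝ × ℝ => (Real.fourierChar (-(p.2 * (y - p.1))) : ℂ) :=
          continuous_subtype_val.comp (Real.continuous_fourierChar.comp (by fun_prop))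
        exact this.measurable
      simp only [Circle.smul_def, smul_eq_mul, Function.uncurry_def]
      exact Measurable.aestronglyMeasurable (by fun_prop)
    · simp [Function.uncurry]
  calc _ = ∫ t in Ioi (0 : ℝ), ∫ v : ℝ,
        a t * cexp (-(σ * t)) * (Real.fourierChar (-(v * (y - t))) • f v) := by
        congr 1 with t
        rw [Real.fourier_real_eq, integral_const_mul]
    _ = ∫ v : ℝ, ∫ t in Ioi (0 : ℝ),
        a t * cexp (-(σ * t)) * (Real.fourierChar (-(v * (y - t))) • f v) :=
        integral_integral_swap h2
    _ = _ := by
        congr 1 with v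
        simp_rw [key, Circle.smul_def]
        rw [integral_smul, integral_const_mul, hG _ (by simpa using hσ)]

/-- If the Laplace transform of a bounded function extends continuously to the closed right half
plane, the convolutions of the function with Fourier transforms of compactly supported functions
vanish at infinity. -/
theorem tendsto_integral_mul_fourier_sub {a : ℝ → ℂ} {C : ℝ} {G : ℂ → ℂ}
    (ha : Measurable a) (hC : ∀ t, ‖a t‖ ≤ C)
    (hG : ∀ z : ℂ, 0 < z.re → ∫ t in Ioi (0 : ℝ), a t * cexp (-(z * t)) = G z)
    (hGc : ContinuousOn G {z | 0 ≤ z.re})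
    (f : 𝓢(ℝ, ℂ)) (hf : HasCompactSupport f) :
    Tendsto (fun y : ℝ => ∫ t in Ioi (0 : ℝ), a t * 𝓕 (f : ℝ → ℂ) (y - t)) atTop (𝓝 0) := by
  have hpath : ContinuousOn (fun p : ℝ × ℝ => G (p.1 - 2 * Real.pi * p.2 * I))
      (Ici 0 ×ˢ univ) := by
    refine hGc.comp (by fun_prop) fun p hp => ?_
    simpa using hp.1
  have hslice : ∀ σ : ℝ, 0 ≤ σ → Continuous fun v : ℝ => G (σ - 2 * Real.pi * v * I) := by
    intro σ hσ
    rw [← continuousOn_univ]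
    exact hpath.comp (f := fun v : ℝ => (σ, v)) (by fun_prop) fun v _ => ⟨hσ, mem_univ _⟩
  -- Let σ → 0+ in the damped identity. The left side is dominated by the integrable kernel, the
  -- right side by a bound for G over the compact support of f. What remains is a Fourier integral
  -- in y.
  have main : ∀ y : ℝ, ∫ t in Ioi (0 : ℝ), a t * 𝓕 (f : ℝ → ℂ) (y - t) =
      ∫ v : ℝ, Real.fourierChar (-(v * y)) • (f v * G ((0 : ℝ) - 2 * Real.pi * v * I)) := by
    intro y
    have hK : Integrable (fun t : ℝ => 𝓕 (f : ℝ → ℂ) (y - t)) :=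
      (𝓕 f : 𝓢(ℝ, ℂ)).integrable.comp_sub_left y
    have hlim1 : Tendsto (fun σ : ℝ => ∫ t in Ioi (0 : ℝ),
        a t * cexp (-(σ * t)) * 𝓕 (f : ℝ → ℂ) (y - t)) (𝓝[>] 0)
        (𝓝 (∫ t in Ioi (0 : ℝ), a t * 𝓕 (f : ℝ → ℂ) (y - t))) := by
      refine tendsto_integral_filter_of_dominated_convergence
        (fun t => C * ‖𝓕 (f : ℝ → ℂ) (y - t)‖) ?_ ?_ ?_ ?_
      · refine Eventually.of_forall fun σ => ?_
        have := hK.aestronglyMeasurable.restrict (s := Ioi (0 : ℝ))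
        exact AEStronglyMeasurable.mul (by fun_prop) this
      · filter_upwards [self_mem_nhdsWithin] with σ hσ
        filter_upwards [ae_restrict_mem measurableSet_Ioi] with t ht
        rw [norm_mul, norm_mul, Complex.norm_exp]
        have : Real.exp (-((σ : ℂ) * t)).re ≤ 1 := by
          rw [Real.exp_le_one_iff]
          simpa using (mul_pos (mem_Ioi.1 hσ) (mem_Ioi.1 ht)).le
        gcongr
        calc _ ≤ C * 1 := mul_le_mul (hC t) this (Real.exp_pos _).le
              ((norm_nonneg _).trans (hC t))
          _ = C := mul_one C
      · exact (hK.norm.const_mul C).restrict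
      · refine Eventually.of_forall fun t => ?_
        have : Continuous fun σ : ℝ => a t * cexp (-(σ * t)) * 𝓕 (f : ℝ → ℂ) (y - t) := by
          fun_prop
        have h := (this.tendsto 0).mono_left (nhdsWithin_le_nhds (s := Ioi 0))
        simpa using h
    obtain ⟨B, hB⟩ := ((isCompact_Icc (a := (0 : ℝ)) (b := 1)).prod hf).exists_bound_of_continuousOn
      (hpath.mono (prod_mono Icc_subset_Ici_self (subset_univ _)))
    have hlim2 : Tendsto (fun σ : ℝ =>
        ∫ v : ℝ, Real.fourierChar (-(v * y)) • (f v * G (σ - 2 * Real.pi * v * I))) (𝓝[>] 0)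
        (𝓝 (∫ v : ℝ, Real.fourierChar (-(v * y)) • (f v * G ((0 : ℝ) - 2 * Real.pi * v * I)))) := by
      refine tendsto_integral_filter_of_dominated_convergence (fun v => ‖f v‖ * B) ?_ ?_ ?_ ?_
      · filter_upwards [self_mem_nhdsWithin] with σ hσ
        refine Continuous.aestronglyMeasurable ?_
        exact (Real.continuous_fourierChar.comp (by fun_prop)).smul
          (f.continuous.mul (hslice σ (le_of_lt hσ)))
      · filter_upwards [Ioc_mem_nhdsGT (zero_lt_one' ℝ)] with σ hσ
        refine Eventually.of_forall fun v => ?_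
        rw [Circle.norm_smul, norm_mul]
        by_cases hv : v ∈ tsupport f
        · gcongr
          exact hB (σ, v) ⟨⟨hσ.1.le, hσ.2⟩, hv⟩
        · simp [image_eq_zero_of_notMem_tsupport hv]
      · exact f.integrable.norm.mul_const B
      · refine Eventually.of_forall fun v => ?_
        have h0 : Tendsto (fun σ : ℝ => G (σ - 2 * Real.pi * v * I)) (𝓝[>] 0)
            (𝓝 (G ((0 : ℝ) - 2 * Real.pi * v * I))) := by
          have : ContinuousOn (fun σ : ℝ => G (σ - 2 * Real.pi * v * I)) (Ici 0) :=
            hpath.comp (f := fun σ : ℝ => (σ, v)) (by fun_prop) fun σ hσ => ⟨hσ, mem_univ _⟩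
          exact (this 0 self_mem_Ici).mono_left (nhdsWithin_mono _ Ioi_subset_Ici_self)
        exact (h0.const_mul _).const_smul _
    refine tendsto_nhds_unique hlim1 (hlim2.congr' ?_)
    filter_upwards [self_mem_nhdsWithin] with σ hσ
    exact (integral_mul_exp_mul_fourier_eq ha hC hG f hσ y).symm
  simp_rw [main]
  exact (Real.tendsto_integral_exp_smul_cocompact _).mono_left atTop_le_cocompact

/-- Fourier inversion at 0: the integral of the transform is f(0), which is 1 for a bump function.
-/
theorem exists_schwartzMap_hasCompactSupport_integral_fourier_eq_one :
    ∃ f : 𝓢(ℝ, ℂ), HasCompactSupport f ∧ ∫ t, 𝓕 (f : ℝ → ℂ) t = 1 := by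
  let b : ContDiffBump (0 : ℝ) := default
  have hb : HasCompactSupport fun x : ℝ => ((b x : ℝ) : ℂ) :=
    b.hasCompactSupport.comp_left (g := Complex.ofReal) Complex.ofReal_zero
  have hs : ContDiff ℝ ((⊤ : ℕ∞) : WithTop ℕ∞) fun x : ℝ => ((b x : ℝ) : ℂ) :=
    Complex.ofRealCLM.contDiff.comp b.contDiff
  let f : 𝓢(ℝ, ℂ) := hb.toSchwartzMap hs
  refine ⟨f, hb, ?_⟩
  have hinv : 𝓕⁻ (𝓕 (f : ℝ → ℂ)) = f :=
    f.continuous.fourierInv_fourier_eq f.integrable (𝓕 f : 𝓢(ℝ, ℂ)).integrable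
  have h0 := congrFun hinv 0
  rw [Real.fourierInv_eq] at h0
  have hf0 : f 0 = 1 := by
    change ((b 0 : ℝ) : ℂ) = 1
    rw [b.one_of_mem_closedBall (Metric.mem_closedBall_self b.rIn_pos.le), Complex.ofReal_one]
  simpa [hf0] using h0

theorem exists_integral_indicator_compl_Icc_norm_lt {K : ℝ → ℂ} (hK : Integrable K) {ε : ℝ}
    (hε : 0 < ε) : ∃ R : ℝ, 0 < R ∧ ∫ t, (Icc (-R) R)ᶜ.indicator (fun t => ‖K t‖) t < ε := by
  have h := (aecover_Icc (μ := (volume : Measure ℝ)) tendsto_neg_atTop_atBot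
    tendsto_id).integral_tendsto_of_countably_generated hK.norm
  obtain ⟨R, hR, hR0⟩ := ((h.eventually (lt_mem_nhds (sub_lt_self _ hε))).and
    (eventually_gt_atTop 0)).exists
  refine ⟨R, hR0, ?_⟩
  have hadd := integral_add_compl (μ := volume) (measurableSet_Icc (a := -R) (b := R)) hK.norm
  rw [integral_indicator measurableSet_Icc.compl]
  simp only [id_eq] at hR
  linarith

/-- A Tauberian theorem: a bounded slowly oscillating function whose Laplace transform extends
continuously to the closed right half plane tends to zero. -/
theorem tendsto_zero_of_laplace_continuousOn {a : ℝ → ℂ} {C : ℝ} {G : ℂ → ℂ}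
    (ha : Measurable a) (hC : ∀ t, ‖a t‖ ≤ C) (ha0 : ∀ t < 0, a t = 0)
    (hG : ∀ z : ℂ, 0 < z.re → ∫ t in Ioi (0 : ℝ), a t * cexp (-(z * t)) = G z)
    (hGc : ContinuousOn G {z | 0 ≤ z.re})
    (hslow : ∀ ε > 0, ∃ δ > 0, ∃ T, ∀ t ≥ T, ∀ s, |t - s| ≤ δ → ‖a t - a s‖ ≤ ε) :
    Tendsto a atTop (𝓝 0) := by
  obtain ⟨f, hf, hf1⟩ := exists_schwartzMap_hasCompactSupport_integral_fourier_eq_one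
  set K : ℝ → ℂ := 𝓕 (f : ℝ → ℂ) with hKdef
  have hK : Integrable K := (𝓕 f : 𝓢(ℝ, ℂ)).integrable
  have hC0 : 0 ≤ C := (norm_nonneg _).trans (hC 0)
  -- Narrowing the kernel by r amounts to dilating a: t ↦ a(rt) has Laplace transform r⁻¹G(z/r),
  -- still continuous up to the boundary.
  have hconv : ∀ r : ℝ, 0 < r →
      Tendsto (fun y : ℝ => ∫ t, a (y - r * t) * K t) atTop (𝓝 0) := by
    intro r hr
    have h := tendsto_integral_mul_fourier_sub (a := fun t => a (r * t)) (C := C)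
      (G := fun z => (r : ℂ)⁻¹ * G (z / r)) (ha.comp (measurable_const_mul r)) (fun t => hC _)
      (fun z hz => by
        have hzr : 0 < (z / r).re := by
          rw [Complex.div_ofReal_re]
          positivity
        rw [← hG _ hzr]
        have := integral_comp_mul_left_Ioi (fun t : ℝ => a t * cexp (-(z / r * t))) 0 hr
        rw [mul_zero, Complex.real_smul, Complex.ofReal_inv] at this
        rw [← this]
        congr 1 with t
        have hr' : (r : ℂ) ≠ 0 := by exact_mod_cast hr.ne'
        congr 2
        push_cast
        field_simp)
      (continuousOn_const.mul (hGc.comp (by fun_prop) fun z hz => by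
        have hz' : 0 ≤ z.re := hz
        change 0 ≤ (z / r).re
        rw [Complex.div_ofReal_re]
        positivity)) f hf
    have h' := h.comp (tendsto_id.atTop_div_const hr)
    refine h'.congr fun y => ?_
    simp only [Function.comp_apply, id_eq]
    -- As a vanishes on the negatives, the half-line integral is a full convolution.
    rw [← integral_Ici_eq_integral_Ioi, setIntegral_eq_integral_of_forall_compl_eq_zero,
      ← integral_sub_left_eq_self _ volume (y / r)]
    · congr 1 with t
      congr 2
      · field_simp
      · rw [sub_sub_cancel]
    · intro t ht
      rw [ha0 _ (mul_neg_of_pos_of_neg hr (by simpa using ht)), zero_mul]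
  rw [Metric.tendsto_atTop']
  intro η hη
  set S : ℝ := ∫ t, ‖K t‖
  have hS : 0 ≤ S := integral_nonneg fun _ => norm_nonneg _
  -- The errors are εS from |t| ≤ R, 2Cε from the tail and ε from the convolution; the last 1 is
  -- slack.
  set ε : ℝ := η / (S + 2 * C + 1 + 1) with hεdef
  have hε : 0 < ε := by positivity
  obtain ⟨δ, hδ, T, hT⟩ := hslow ε hε
  obtain ⟨R, hR, hRK⟩ := exists_integral_indicator_compl_Icc_norm_lt hK hε
  -- With r = δ/R, every |t| ≤ R shifts the argument by at most δ.
  have hr : 0 < δ / R := by positivity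
  obtain ⟨Y, hY⟩ := Metric.tendsto_atTop.1 (hconv _ hr) ε hε
  refine ⟨max T Y, fun y hy => ?_⟩
  have hyT : y ≥ T := (le_max_left _ _).trans hy.le
  have hyY := hY y ((le_max_right _ _).trans hy.le)
  rw [dist_zero_right] at hyY ⊢
  have hi1 : Integrable fun t => a (y - δ / R * t) * K t :=
    hK.bdd_mul (c := C) (ha.comp (by fun_prop)).aestronglyMeasurable
      (Eventually.of_forall fun t => hC _)
  have hi2 : Integrable fun t => (Icc (-R) R)ᶜ.indicator (fun t => ‖K t‖) t :=
    hK.norm.indicator measurableSet_Icc.compl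
  have hdiff : ‖a y - ∫ t, a (y - δ / R * t) * K t‖ ≤ ε * S + 2 * C * ε := by
    have e : a y - ∫ t, a (y - δ / R * t) * K t =
        ∫ t, (a y * K t - a (y - δ / R * t) * K t) := by
      rw [integral_sub (hK.const_mul _) hi1, integral_const_mul, hf1, mul_one]
    rw [e]
    calc _ ≤ ∫ t, (ε * ‖K t‖ + 2 * C * (Icc (-R) R)ᶜ.indicator (fun t => ‖K t‖) t) := by
          refine norm_integral_le_of_norm_le ((hK.norm.const_mul ε).add (hi2.const_mul _))
            (Eventually.of_forall fun t => ?_)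
          rw [← sub_mul, norm_mul]
          by_cases ht : t ∈ Icc (-R) R
          · rw [indicator_of_notMem (by simpa using ht), mul_zero, add_zero]
            gcongr
            refine hT y hyT _ ?_
            rw [sub_sub_cancel, abs_mul, abs_of_pos hr]
            calc δ / R * |t| ≤ δ / R * R := by
                  gcongr
                  exact abs_le.2 ht
              _ = δ := div_mul_cancel₀ _ hR.ne'
          · rw [indicator_of_mem (by simpa using ht)]
            have h1 : ‖a y - a (y - δ / R * t)‖ ≤ 2 * C :=
              (norm_sub_le _ _).trans (by linarith [hC y, hC (y - δ / R * t)])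
            have := mul_le_mul_of_nonneg_right h1 (norm_nonneg (K t))
            have := mul_nonneg hε.le (norm_nonneg (K t))
            linarith
      _ = ε * S + 2 * C * ∫ t, (Icc (-R) R)ᶜ.indicator (fun t => ‖K t‖) t := by
          rw [integral_add (hK.norm.const_mul ε) (hi2.const_mul _), integral_const_mul,
            integral_const_mul]
      _ ≤ _ := by gcongr
  calc ‖a y‖ ≤ ‖a y - ∫ t, a (y - δ / R * t) * K t‖ + ‖∫ t, a (y - δ / R * t) * K t‖ := by
        simpa using norm_add_le (a y - ∫ t, a (y - δ / R * t) * K t)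
          (∫ t, a (y - δ / R * t) * K t)
    _ < ε * S + 2 * C * ε + ε + ε := by linarith
    _ = η := by
        rw [hεdef]
        field_simp

/-! ### Boundedness and slow oscillation of M(e^t)e^{-t} -/

theorem measurable_mertensFunction : Measurable mertensFunction :=
  (measurable_from_nat (f := fun N : ℕ => ∑ n ∈ Finset.Icc 1 N,
    (ArithmeticFunction.moebius n : ℝ))).comp Nat.measurable_floor

theorem abs_moebius_real_le_one (n : ℕ) : |(ArithmeticFunction.moebius n : ℝ)| ≤ 1 := by
  exact_mod_cast ArithmeticFunction.abs_moebius_le_one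

theorem mertensFunction_of_lt_one {x : ℝ} (hx : x < 1) : mertensFunction x = 0 := by
  simp [mertensFunction, Nat.floor_eq_zero.2 hx]

theorem abs_mertensFunction_le {x : ℝ} (hx : 0 ≤ x) : |mertensFunction x| ≤ x := by
  calc |mertensFunction x| ≤ ∑ n ∈ Finset.Icc 1 ⌊x⌋₊, |(ArithmeticFunction.moebius n : ℝ)| :=
        Finset.abs_sum_le_sum_abs _ _
    _ ≤ ∑ n ∈ Finset.Icc 1 ⌊x⌋₊, (1 : ℝ) :=
        Finset.sum_le_sum fun n _ => abs_moebius_real_le_one n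
    _ ≤ x := by simpa using Nat.floor_le hx

theorem abs_mertensFunction_sub_le {x y : ℝ} (hx : 0 ≤ x) (hxy : x ≤ y) :
    |mertensFunction y - mertensFunction x| ≤ y - x + 1 := by
  have hfl : ⌊x⌋₊ ≤ ⌊y⌋₊ := Nat.floor_le_floor hxy
  have hsub : mertensFunction y - mertensFunction x =
      ∑ n ∈ Finset.Ioc ⌊x⌋₊ ⌊y⌋₊, (ArithmeticFunction.moebius n : ℝ) := by
    rw [mertensFunction, mertensFunction, ← Finset.sum_sdiff (Finset.Icc_subset_Icc_right hfl),
      add_sub_cancel_right]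
    refine Finset.sum_congr ?_ fun _ _ => rfl
    ext n
    simp only [Finset.mem_sdiff, Finset.mem_Icc, Finset.mem_Ioc]
    omega
  rw [hsub]
  calc _ ≤ ∑ n ∈ Finset.Ioc ⌊x⌋₊ ⌊y⌋₊, |(ArithmeticFunction.moebius n : ℝ)| :=
        Finset.abs_sum_le_sum_abs _ _
    _ ≤ ∑ n ∈ Finset.Ioc ⌊x⌋₊ ⌊y⌋₊, (1 : ℝ) :=
        Finset.sum_le_sum fun n _ => abs_moebius_real_le_one n
    _ = (⌊y⌋₊ : ℝ) - ⌊x⌋₊ := by simp [Nat.cast_sub hfl]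
    _ ≤ y - x + 1 := by
        have h1 := Nat.floor_le (hx.trans hxy)
        have h2 := Nat.lt_floor_add_one x
        linarith

/-- The rescaled Mertens function `t ↦ M(e ^ t) / e ^ t`. -/
noncomputable def mertensExp (t : ℝ) : ℝ := mertensFunction (Real.exp t) * Real.exp (-t)

theorem measurable_mertensExp : Measurable mertensExp :=
  (measurable_mertensFunction.comp Real.measurable_exp).mul (by fun_prop)

theorem abs_mertensExp_le_one (t : ℝ) : |mertensExp t| ≤ 1 := by
  rw [mertensExp, abs_mul, abs_of_pos (Real.exp_pos _)]
  calc _ ≤ Real.exp t * Real.exp (-t) := by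
        gcongr
        exact abs_mertensFunction_le (Real.exp_pos t).le
    _ = 1 := by rw [← Real.exp_add]; simp

theorem mertensExp_of_neg {t : ℝ} (ht : t < 0) : mertensExp t = 0 := by
  rw [mertensExp, mertensFunction_of_lt_one (Real.exp_lt_one_iff.2 ht), zero_mul]

/-- The increment of M and the change of normalisation each cost at most 1 - e^{s-t} ≤ t - s; the
rounding in the floors costs e^{-t}. -/
theorem abs_mertensExp_sub_le {s t : ℝ} (hst : s ≤ t) :
    |mertensExp t - mertensExp s| ≤ 2 * (t - s) + Real.exp (-t) := by
  have h1 := abs_mertensFunction_sub_le (Real.exp_pos s).le (Real.exp_le_exp.2 hst)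
  have h2 := abs_mertensFunction_le (Real.exp_pos s).le
  have hle : Real.exp (-t) ≤ Real.exp (-s) := Real.exp_le_exp.2 (by linarith)
  have hs : Real.exp s * Real.exp (-s) = 1 := by rw [← Real.exp_add]; simp
  have ht : Real.exp t * Real.exp (-t) = 1 := by rw [← Real.exp_add]; simp
  have hd : Real.exp s * Real.exp (-t) = Real.exp (s - t) := by rw [← Real.exp_add]; ring_nf
  have hexp := Real.add_one_le_exp (s - t)
  have heq : mertensExp t - mertensExp s =
      (mertensFunction (Real.exp t) - mertensFunction (Real.exp s)) * Real.exp (-t) -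
        mertensFunction (Real.exp s) * (Real.exp (-s) - Real.exp (-t)) := by
    simp only [mertensExp]
    ring
  rw [heq]
  calc _ ≤ |(mertensFunction (Real.exp t) - mertensFunction (Real.exp s)) * Real.exp (-t)| +
        |mertensFunction (Real.exp s) * (Real.exp (-s) - Real.exp (-t))| := abs_sub _ _
    _ ≤ (Real.exp t - Real.exp s + 1) * Real.exp (-t) +
        Real.exp s * (Real.exp (-s) - Real.exp (-t)) := by
        rw [abs_mul, abs_mul, abs_of_pos (Real.exp_pos (-t)), abs_of_nonneg (sub_nonneg.2 hle)]
        gcongr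
    _ = 2 * (1 - Real.exp (s - t)) + Real.exp (-t) := by
        linear_combination ht + hs - 2 * hd
    _ ≤ _ := by linarith

/-! ### Laplace transform and the zeta function -/

/-- The Laplace transform of `mertensExp`, continued to the closed right half plane. -/
noncomputable def mertensLaplace (z : ℂ) : ℂ :=
  z / ((z + 1) * Function.update (fun s : ℂ => (s - 1) * riemannZeta s) 1 1 (z + 1))

/-- The singularity at 1 is removable with value 1, the residue of ζ. -/
theorem continuous_sub_one_mul_riemannZeta :
    Continuous (Function.update (fun s : ℂ => (s - 1) * riemannZeta s) 1 1) := by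
  rw [continuous_iff_continuousAt]
  intro s
  by_cases hs : s = 1
  · subst hs
    exact continuousAt_update_same.2 riemannZeta_residue_one
  · rw [continuousAt_update_of_ne hs]
    exact ((differentiableAt_id.sub_const 1).mul (differentiableAt_riemannZeta hs)).continuousAt

theorem continuousOn_mertensLaplace : ContinuousOn mertensLaplace {z | 0 ≤ z.re} := by
  have h := continuous_sub_one_mul_riemannZeta
  refine ContinuousOn.div continuousOn_id
    ((continuous_id.add continuous_const).mul
      (h.comp (continuous_id.add continuous_const))).continuousOn fun z hz => ?_
  have hz' : 0 ≤ z.re := hz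
  have hz1 : z + 1 ≠ 0 := fun h => by
    have := congrArg Complex.re h
    simp at this
    linarith
  refine mul_ne_zero hz1 ?_
  by_cases h0 : z = 0
  · simp [h0]
  · have : z + 1 ≠ 1 := by simpa using h0
    rw [Function.update_of_ne this]
    exact mul_ne_zero (sub_ne_zero.2 this) (riemannZeta_ne_zero_of_one_le_re (by simpa using hz'))

theorem mertensLaplace_eq {z : ℂ} (hz : 0 < z.re) :
    mertensLaplace z = 1 / ((z + 1) * riemannZeta (z + 1)) := by
  have h0 : z ≠ 0 := fun h => by simp [h] at hz
  rw [mertensLaplace, Function.update_of_ne (by simpa using h0), add_sub_cancel_right,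
    mul_left_comm, div_mul_eq_div_div, div_self h0]

/-- Abel summation gives ∑ μ(n)n^{-s} = s∫₁^∞ M(u)u^{-s-1} du at s = z + 1. Substitute u = e^t and
use ζ(s) ∑ μ(n)n^{-s} = 1. -/
theorem integral_mertensExp_mul_exp {z : ℂ} (hz : 0 < z.re) :
    ∫ t in Ioi (0 : ℝ), (mertensExp t : ℂ) * cexp (-(z * t)) = mertensLaplace z := by
  have hre : 1 < (z + 1).re := by simpa using hz
  have hO : (fun n : ℕ => ∑ k ∈ Finset.Icc 1 n, ((ArithmeticFunction.moebius k : ℤ) : ℂ)) =O[atTop]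
      fun n => (n : ℝ) ^ (1 : ℝ) := by
    refine Asymptotics.isBigO_of_le _ fun n => ?_
    have h := abs_mertensFunction_le (Nat.cast_nonneg (α := ℝ) n)
    rw [mertensFunction, Nat.floor_natCast] at h
    have e : (∑ k ∈ Finset.Icc 1 n, ((ArithmeticFunction.moebius k : ℤ) : ℂ)) =
        ((∑ k ∈ Finset.Icc 1 n, (ArithmeticFunction.moebius k : ℝ) : ℝ) : ℂ) := by push_cast; rfl
    rw [e, Complex.norm_real]
    simpa using h
  have hL := LSeries_eq_mul_integral (fun n => ((ArithmeticFunction.moebius n : ℤ) : ℂ))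
    zero_le_one hre (ArithmeticFunction.LSeriesSummable_moebius_iff.2 hre) hO
  have hz1 : z + 1 ≠ 0 := fun h => by simp [h] at hre; linarith
  have hζ := ArithmeticFunction.LSeries_zeta_mul_Lseries_moebius hre
  rw [ArithmeticFunction.LSeries_zeta_eq_riemannZeta hre, hL] at hζ
  have himage : Real.exp '' Ioi 0 = Ioi 1 := by
    ext x
    constructor
    · rintro ⟨t, ht, rfl⟩
      exact Real.one_lt_exp_iff.2 ht
    · intro hx
      exact ⟨Real.log x, Real.log_pos hx, Real.exp_log (zero_lt_one.trans hx)⟩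
  rw [← himage, integral_image_eq_integral_abs_deriv_smul measurableSet_Ioi
    (fun x _ => (Real.hasDerivAt_exp x).hasDerivWithinAt) Real.exp_injective.injOn] at hζ
  have hcongr : ∀ t : ℝ, |Real.exp t| • ((∑ k ∈ Finset.Icc 1 ⌊Real.exp t⌋₊,
      ((ArithmeticFunction.moebius k : ℤ) : ℂ)) * ((Real.exp t : ℝ) : ℂ) ^ (-(z + 1 + 1))) =
      (mertensExp t : ℂ) * cexp (-(z * t)) := by
    intro t
    have hpow : ((Real.exp t : ℝ) : ℂ) ^ (-(z + 1 + 1)) = cexp (-(z + 1 + 1) * t) := by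
      rw [Complex.cpow_def_of_ne_zero (by exact_mod_cast (Real.exp_pos t).ne'),
        ← Complex.ofReal_log (Real.exp_pos t).le, Real.log_exp, mul_comm]
    rw [hpow, abs_of_pos (Real.exp_pos t), mertensExp, mertensFunction, Complex.real_smul]
    push_cast
    have : cexp t * cexp (-(z + 1 + 1) * t) = cexp (-t) * cexp (-(z * t)) := by
      rw [← Complex.exp_add, ← Complex.exp_add]
      ring_nf
    linear_combination (∑ k ∈ Finset.Icc 1 ⌊Real.exp t⌋₊,
      ((ArithmeticFunction.moebius k : ℤ) : ℂ)) * this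
  simp_rw [hcongr] at hζ
  rw [mertensLaplace_eq hz, eq_div_iff (mul_ne_zero hz1 (left_ne_zero_of_mul_eq_one hζ))]
  linear_combination hζ

/-! ### Conclusion -/

theorem tendsto_mertensExp : Tendsto (fun t => (mertensExp t : ℂ)) atTop (𝓝 0) := by
  refine tendsto_zero_of_laplace_continuousOn (C := 1)
    (Complex.measurable_ofReal.comp measurable_mertensExp)
    (fun t => by simpa using abs_mertensExp_le_one t)
    (fun t ht => by rw [mertensExp_of_neg ht, Complex.ofReal_zero])
    (fun z hz => integral_mertensExp_mul_exp hz) continuousOn_mertensLaplace fun ε hε => ?_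
  obtain ⟨T, hT⟩ := eventually_atTop.1
    (Real.tendsto_exp_neg_atTop_nhds_zero.eventually (gt_mem_nhds (half_pos hε)))
  -- The Lipschitz term is at most 2 · ε/4, and the exponential at the larger of the two points is
  -- below ε/2.
  refine ⟨ε / 4, by positivity, T + ε / 4, fun t ht s hs => ?_⟩
  rw [← Complex.ofReal_sub, Complex.norm_real, Real.norm_eq_abs]
  rw [abs_le] at hs
  rcases le_total s t with h | h
  · have := abs_mertensExp_sub_le h
    have := hT t (by linarith)
    linarith
  · have := abs_mertensExp_sub_le h
    have := hT s (by linarith)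
    rw [abs_sub_comm]
    linarith

theorem mainTheorem4 :
    Asymptotics.IsLittleO Filter.atTop (fun x : ℝ => mertensFunction x) (fun x : ℝ => x) := by
  have hne : ∀ᶠ x : ℝ in atTop, x = 0 → mertensFunction x = 0 := by
    filter_upwards [eventually_gt_atTop 0] with x hx h
    exact absurd h hx.ne'
  rw [Asymptotics.isLittleO_iff_tendsto' hne]
  have h : Tendsto mertensExp atTop (𝓝 0) := by
    exact_mod_cast (Complex.continuous_re.tendsto 0).comp tendsto_mertensExp
  refine (h.comp Real.tendsto_log_atTop).congr' ?_
  filter_upwards [eventually_gt_atTop 0] with x hx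
  rw [Function.comp_apply, mertensExp, Real.exp_neg, Real.exp_log hx, div_eq_mul_inv]
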